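/- Let $q\ge 2$ and let $n,k,d,r,t,s\ge 1$ be integers. **Codes.** An $[n,k,d]$ quantum code is a subspace $\mathcal C\subseteq(\mathbb C^q)^{\otimes n}$ of dimension $q^k$ with distance (at least) $d$: for every operator $E$ acting on fewer than $d$ qudits there is a constant $c_E$ with $\langle\varphi|E|\psi\rangle=c_E\langle\varphi|\psi\rangle$ for all $\varphi,\psi\in\mathcal C$ (Knill–Laflamme condition). **Exact $(r,t,s)$-qLRC.** The code $\mathcal C$ is an exact $(r,t,s)$-qLRC if there are sets $\Gamma_l(j)\subseteq[n]$ ($1\le l\le t$, $1\le j\le n$) such that 1. $j\in\Gamma_l(j)$ and $|\Gamma_l(j)|=r+1$ for all $j,l$; 2. $|\Gamma_{l_1}(j)\cap\Gamma_{l_2}(j)|=s+1$ for all $j$ and all $l_1\ne l_2$; 3. $\Gamma_{l_1}(j)\cap\Gamma_{l_2}(j)\cap\Gamma_{l_3}(j)=\{j\}$ for all $j$ and all distinct $l_1,l_2,l_3$; and for all $l,j$ there is a quantum channel $\mathrm{Rec}_{l,j}$ supported on the qudits in $\Gamma_l(j)$ with $\mathrm{Rec}_{l,j}(\mathrm{Tr}_j(|\psi\rangle\langle\psi|))=|\psi\rangle\langle\psi|$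 for every unit vector $\psi\in\mathcal C$, where $\mathrm{Tr}_j$ is the loss of qudit $j$ (as an operator on all $n$ qudits, the partial trace over $j$ with the maximally mixed state at position $j$). **The quantity $\mathcal N_1$.** Put $N_e(r,L,s)=\frac{2r-(L-1)s}{2}L+1$. With the convention $\binom ab=0$ for $a<b$, put $$\tilde f_e(m,e,r,T,s)=\sum_{L=1}^{T}(-1)^{L+1}\binom TL\,\frac{\binom{m-N_e(r,L,s)}{e}}{\binom me}\,\frac1{N_e(r,L,s)}$$ (so that $\tilde f_e=0$ for $T=0$), and $$\mathcal N_1(m,e,r,t,s)=\max_{0\le T\le t,\ N_e(r,T,s)\le m}\bigl\lceil m\,\tilde f_e(m,e,r,T,s)\bigr\rceil .$$ **Theorem.** If $\mathcal C$ is an $[n,k,d]$ quantum code and an exact $(r,t,s)$-qLRC, then $$k\le n-2(d-1)-\mathcal N_1(n,d-1,r,t,s)-\mathcal N_1\bigl(n-(d-1)-\mathcal N_1(n,d-1,r,t,s),\,d-1,r,t,s\bigr).$$ -/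

import Mathlib

/-! ### Quantum codes on `n` qudits of local dimension `q` -/

/-- The Hilbert space `(ℂ^q)^{⊗ n}`, with orthonormal computational basis indexed by
the words in `Fin n → Fin q`. -/
abbrev QuditSpace (n q : ℕ) : Type := EuclideanSpace ℂ (Fin n → Fin q)

/-- Operators on the `n`-qudit space, as matrices in the computational basis. -/
abbrev QuditOp (n q : ℕ) : Type := Matrix (Fin n → Fin q) (Fin n → Fin q) ℂ

/-- Operators on the qudits in `S` only. -/
abbrev SubsystemOp {n : ℕ} (q : ℕ) (S : Finset (Fin n)) : Type :=
  Matrix (S → Fin q) (S → Fin q) ℂ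

/-- The operator `N ⊗ 1` on all `n` qudits, where `N` acts on the qudits in `S` and the identity
acts on the qudits outside `S`. -/
def localOp {n q : ℕ} (S : Finset (Fin n)) (N : SubsystemOp q S) : QuditOp n q :=
  Matrix.of fun x y =>
    if ∀ i, i ∉ S → x i = y i then N (fun i => x i) (fun i => y i) else 0

/-- The rank one operator `|ψ⟩⟨ψ|`. -/
def pureState {n q : ℕ} (ψ : QuditSpace n q) : QuditOp n q :=
  Matrix.of fun x y => ψ x * star (ψ y)

/-- The loss of qudit `j`: the partial trace `Tr_j ρ`, regarded as an operator on all `n` qudits by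
putting the maximally mixed state `I / q` at the (now uninformative) position `j`, that is,
`(I / q)_j ⊗ Tr_j ρ`. For qubits this is `(ρ + X_j ρ X_j + Y_j ρ Y_j + Z_j ρ Z_j) / 4`. -/
noncomputable def traceOut {n q : ℕ} (j : Fin n) (ρ : QuditOp n q) : QuditOp n q :=
  Matrix.of fun x y =>
    if x j = y j then
      (q : ℂ)⁻¹ * ∑ c : Fin q, ρ (Function.update x j c) (Function.update y j c)
    else 0

/-- A quantum channel supported on the qudits in `S`, given by finitely many Kraus operators on
these qudits. -/
structure LocalChannel {n : ℕ} (q : ℕ) (S : Finset (Fin n)) where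
  /-- the number of Kraus operators -/
  size : ℕ
  /-- the Kraus operators -/
  kraus : Fin size → SubsystemOp q S
  /-- the channel preserves the trace -/
  trace_preserving : ∑ a, (kraus a).conjTranspose * kraus a = 1

/-- The action on all `n` qudits of a channel supported on `S`: it is tensored with the identity
channel on the qudits outside `S`. -/
def LocalChannel.apply {n q : ℕ} {S : Finset (Fin n)} (R : LocalChannel q S)
    (ρ : QuditOp n q) : QuditOp n q :=
  ∑ a, localOp S (R.kraus a) * ρ * (localOp S (R.kraus a)).conjTranspose

/-- The code `C` has distance at least `d`: the Knill-Laflamme condition `P E P = c_E P` holds for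
every error `E` that acts on fewer than `d` qudits (equivalently, the loss of any `d - 1` qudits at
known positions can be corrected). -/
def HasDistance {n q : ℕ} (C : Submodule ℂ (QuditSpace n q)) (d : ℕ) : Prop :=
  ∀ S : Finset (Fin n), S.card < d → ∀ N : SubsystemOp q S,
    ∃ c : ℂ, ∀ φ ∈ C, ∀ ψ ∈ C,
      inner ℂ φ (Matrix.toEuclideanLin (localOp S N) ψ) = c * inner ℂ φ ψ

/-- An `[n, k, d]` quantum code over qudits of local dimension `q`: a `q ^ k`-dimensional subspace
of distance (at least) `d`. -/
structure IsQuantumCode {n q : ℕ} (C : Submodule ℂ (QuditSpace n q)) (k d : ℕ) : Prop where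
  finrank_eq : Module.finrank ℂ C = q ^ k
  distance : HasDistance C d

/-! ### Exact `(r,t,s)`-qLRCs -/

/-- The exact `(r,t,s)`-condition for a family `Γ_l(j)`, `l ∈ [t]`, `j ∈ [n]`, of subsets
of `[n]`. -/
structure ExactCondition {n t : ℕ} (r s : ℕ) (Γ : Fin t → Fin n → Finset (Fin n)) : Prop where
  mem : ∀ l j, j ∈ Γ l j
  card : ∀ l j, (Γ l j).card = r + 1
  card_inter : ∀ j l₁ l₂, l₁ ≠ l₂ → (Γ l₁ j ∩ Γ l₂ j).card = s + 1
  inter_three : ∀ j l₁ l₂ l₃, l₁ ≠ l₂ → l₁ ≠ l₃ → l₂ ≠ l₃ →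
    Γ l₁ j ∩ Γ l₂ j ∩ Γ l₃ j = {j}

/-- `C` is an exact `(r,t,s)`-qLRC: there are recovery sets `Γ_l(j)` with the exact
`(r,t,s)`-condition and, for all `l` and `j`, a recovery channel supported on `Γ_l(j)` that restores
every code state after the loss of qudit `j`. -/
def IsExactQLRC {n q : ℕ} (C : Submodule ℂ (QuditSpace n q)) (r t s : ℕ) : Prop :=
  ∃ Γ : Fin t → Fin n → Finset (Fin n), ExactCondition r s Γ ∧
    ∀ (l : Fin t) (j : Fin n), ∃ R : LocalChannel q (Γ l j),
      ∀ ψ ∈ C, ‖ψ‖ = 1 → R.apply (traceOut j (pureState ψ)) = pureState ψ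

/-! ### The quantity `𝒩₁` -/

/-- `N_e(r,L,s) = (2r - (L-1)s)/2 · L + 1`; the division by two is exact. -/
def unionSize (r L s : ℕ) : ℤ := (2 * (r : ℤ) - ((L : ℤ) - 1) * s) * L / 2 + 1

/-- The binomial coefficient, with the convention that it is `0` whenever `a < b`. -/
def binom (a : ℤ) (b : ℕ) : ℚ := if a < b then 0 else (a.toNat.choose b : ℚ)

/-- `f̃_e(m,e,r,T,s) = ∑_{1 ≤ L ≤ T} (-1)^{L+1} C(T,L) · C(m - N_e(r,L,s), e) / C(m,e)
· 1 / N_e(r,L,s)`. -/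
def fTilde (m : ℤ) (e r T s : ℕ) : ℚ :=
  ∑ L ∈ Finset.Icc 1 T, (-1 : ℚ) ^ (L + 1) * (T.choose L : ℚ) *
    (binom (m - unionSize r L s) e / binom m e) * (1 / (unionSize r L s : ℚ))

/-- `𝒩₁(m,e,r,t,s)`, the maximum of `⌈m · f̃_e(m,e,r,T,s)⌉` over all `0 ≤ T ≤ t`
with `N_e(r,T,s) ≤ m`. For `m ≥ 1` the index `T = 0` is admissible and contributes `0`, so the
maximum is not negative and the natural number ceiling does not change it. -/
def calN₁ (m : ℤ) (e r t s : ℕ) : ℕ :=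
  ((Finset.range (t + 1)).filter fun T => unionSize r T s ≤ m).sup
    fun T => ⌈(m : ℚ) * fTilde m e r T s⌉₊

/-! Two disjoint sets `A`, `B` of qudits whose erasures are each correctable leave at least `k`
qudits outside `A ∪ B`. This Singleton bound (`card_le_card_of_no_information`) is proved with ranks
instead of entropies. It remains to find large correctable sets.

By the distance, any `d - 1` qudits `E` are correctable. A further qudit `j` may be added to a
correctable set that misses one of its recovery sets (`Correctable.insert`). So if the qudits of `J
⊆ M` have recovery sets that avoid `E` and meet `M` only in `j` and qudits earlier in some order,
then `E ∪ J` is correctable: add `J` from the latest qudit to the earliest.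

To make `J` large, choose `E ⊆ M` and the order at random. A set `B` containing `j` avoids `E` and
has `j` last with probability `C(m - |B|, e) / C(m, e) · 1 / |B|`. Such events for several sets
intersect in the event for their union, and the exact condition fixes the sizes of the unions, so
inclusion-exclusion gives `fTilde` (`card_biUnion_goodPairs`).

This is used for `M = [n]`, giving `A`, and then for `M = Aᶜ`, giving `B`. The two erasures are
considered separately, so recovery sets for `B` may use qudits of `A`. -/

section Rank

/-! ### Rank inequalities and the tripartite Singleton bound. -/

open scoped Kronecker ComplexOrder

/-- The rank of `1 ⊗ M` is at least the number of blocks times the rank of `M`. -/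
theorem card_mul_rank_le_rank_one_kronecker {K κ α : Type*} [Field K] [Fintype κ] [DecidableEq κ]
    [Fintype α] [DecidableEq α] (M : Matrix α α K) :
    Fintype.card κ * M.rank ≤ ((1 : Matrix κ κ K) ⊗ₖ M).rank := by
  obtain ⟨V, U, e, -, -, h⟩ := Matrix.exists_rank_normal_form M
  -- `f` selects the identity corner of the normal form in every diagonal block.
  let f : κ × Fin M.rank → κ × α := fun x => (x.1, e.symm (Sum.inl x.2))
  have h1 : (((1 : Matrix κ κ K) ⊗ₖ (V * M * U)).submatrix f f) = 1 := by
    ext ⟨i, x⟩ ⟨j, y⟩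
    rw [h]
    simp [f, Matrix.kroneckerMap_apply, Matrix.one_apply, ite_and, and_comm (a := i = j)]
  have h2 : (1 : Matrix κ κ K) ⊗ₖ (V * M * U) = (1 ⊗ₖ V) * (1 ⊗ₖ M) * (1 ⊗ₖ U) := by
    rw [← Matrix.mul_kronecker_mul, ← Matrix.mul_kronecker_mul, one_mul, one_mul]
  calc Fintype.card κ * M.rank = (1 : Matrix (κ × Fin M.rank) (κ × Fin M.rank) K).rank := by
        simp [Matrix.rank_one]
    _ ≤ ((1 : Matrix κ κ K) ⊗ₖ (V * M * U)).rank := h1 ▸ Matrix.rank_submatrix_le _ _ _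
    _ ≤ _ := by
      rw [h2]
      exact (Matrix.rank_mul_le_left _ _).trans (Matrix.rank_mul_le_right _ _)

theorem Matrix.rank_sum_le {K m n ι : Type*} [Field K] [Fintype n] [Fintype m] (s : Finset ι)
    (M : ι → Matrix m n K) : (∑ i ∈ s, M i).rank ≤ ∑ i ∈ s, (M i).rank := by
  classical
  induction s using Finset.induction_on with
  | empty => simp
  | insert a s ha ih =>
    rw [Finset.sum_insert ha, Finset.sum_insert ha]
    refine le_trans ?_ (Nat.add_le_add_left ih _)
    rw [Matrix.rank, Matrix.mulVecLin_add]
    exact (Submodule.finrank_mono (LinearMap.range_add_le _ _)).trans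
      (Submodule.finrank_add_le_finrank_add_finrank _ _)

/-- The rank across the cut `X | β × γ` is at most `|γ|` times the rank across the
cut `β | X × γ`. -/
theorem rank_cut_le {K X β γ : Type*} [Field K] [Fintype X] [Fintype β] [Fintype γ]
    (ψ : X → β → γ → K) :
    (Matrix.of fun (x : X) (y : β × γ) => ψ x y.1 y.2).rank ≤
      Fintype.card γ * (Matrix.of fun (b : β) (y : X × γ) => ψ y.1 b y.2).rank := by
  classical
  set N := Matrix.of fun (b : β) (y : X × γ) => ψ y.1 b y.2
  -- `P c` places `β` as the slice `β × {c}`; each slice of the left-hand matrix is a transposed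
  -- column selection of `N`.
  let P (c : γ) : Matrix β (β × γ) K := Matrix.of fun b y => if y = (b, c) then 1 else 0
  have h : (Matrix.of fun (x : X) (y : β × γ) => ψ x y.1 y.2) =
      ∑ c, (N.submatrix id (fun x : X => (x, c))).transpose * P c := by
    ext x ⟨b, c⟩
    simp only [Matrix.sum_apply, Matrix.mul_apply, Matrix.of_apply, P, N, Matrix.transpose_apply,
      Matrix.submatrix_apply, Prod.mk.injEq, id]
    rw [Finset.sum_eq_single c, Finset.sum_eq_single b] <;> simp +contextual [eq_comm]
  rw [h]
  refine (Matrix.rank_sum_le _ _).trans ?_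
  refine (Finset.sum_le_card_nsmul _ _ N.rank fun c _ => ?_).trans (by simp)
  refine (Matrix.rank_mul_le_left _ _).trans ?_
  rw [Matrix.rank_transpose]
  exact Matrix.rank_submatrix_le _ _ _

section Tripartite

variable {κ α β γ : Type*} [Fintype κ] [Fintype α] [Fintype β] [Fintype γ]
  [DecidableEq κ]

/-- If the `κ` orthonormal states `ψ i` all have the same reduced state `G` on `α` and reveal
nothing about `i` there, then `|κ|` times the rank of `G` is at most `|γ|` times the rank across
the cut `β | rest`. -/
theorem card_mul_rank_le (ψ : κ → α → β → γ → ℂ) (G : Matrix α α ℂ)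
    (hG : ∀ i i' a a', ∑ b, ∑ c, ψ i a b c * star (ψ i' a' b c) = if i = i' then G a a' else 0) :
    Fintype.card κ * G.rank ≤ Fintype.card γ *
      (Matrix.of fun (b : β) (y : (κ × α) × γ) => ψ y.1.1 y.1.2 b y.2).rank := by
  classical
  refine le_trans ?_ (rank_cut_le fun (x : κ × α) b c => ψ x.1 x.2 b c)
  -- By `hG` the Gram matrix across `(κ × α) | (β × γ)` is `1 ⊗ G`: the label and `α` are
  -- uncorrelated.
  rw [← Matrix.rank_self_mul_conjTranspose (Matrix.of fun (x : κ × α) (y : β × γ) => _)]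
  refine (card_mul_rank_le_rank_one_kronecker G).trans (le_of_eq ?_)
  congr 1
  ext ⟨i, a⟩ ⟨i', a'⟩
  simp [Matrix.mul_apply, Fintype.sum_prod_type, Matrix.kroneckerMap_apply, Matrix.one_apply,
    ← hG i i' a a']

/-- The Gram matrix across this cut sums over the label, so only the diagonal cases of `hH` enter
and it equals `|κ| • H`. -/
theorem rank_cut_eq [Nonempty κ] (ψ : κ → α → β → γ → ℂ) (H : Matrix β β ℂ)
    (hH : ∀ i i' b b', ∑ a, ∑ c, ψ i a b c * star (ψ i' a b' c) = if i = i' then H b b' else 0) :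
    (Matrix.of fun (b : β) (y : (κ × α) × γ) => ψ y.1.1 y.1.2 b y.2).rank = H.rank := by
  rw [← Matrix.rank_self_mul_conjTranspose (Matrix.of _),
    ← Matrix.rank_smul_of_mem_nonZeroDivisors (c := (Fintype.card κ : ℂ)) H (by simp)]
  congr 1
  ext b b'
  have h i := hH i i b b'
  simp only [if_true, RCLike.star_def] at h
  simp [Matrix.mul_apply, Fintype.sum_prod_type, h]

/-- The quantum Singleton bound for a tripartite system: if neither `α` nor `β` holds any
information about which of the `κ` states has been prepared, then `|κ| ≤ |γ|`. -/
theorem card_le_card_of_no_information (ψ : κ → α → β → γ → ℂ) (hψ : ψ ≠ 0) (G : Matrix α α ℂ)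
    (H : Matrix β β ℂ)
    (hG : ∀ i i' a a', ∑ b, ∑ c, ψ i a b c * star (ψ i' a' b c) = if i = i' then G a a' else 0)
    (hH : ∀ i i' b b', ∑ a, ∑ c, ψ i a b c * star (ψ i' a b' c) = if i = i' then H b b' else 0) :
    Fintype.card κ ≤ Fintype.card γ := by
  rcases isEmpty_or_nonempty κ with hκ | hκ
  · simp
  let ψ' : κ → β → α → γ → ℂ := fun i b a c => ψ i a b c
  have h1 := card_mul_rank_le ψ G hG
  have h2 := card_mul_rank_le ψ' H hH
  have h3 := rank_cut_eq ψ H hH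
  rw [h3] at h1
  rw [rank_cut_eq ψ' G hG] at h2
  have h4 : H.rank ≠ 0 := by
    rw [← h3]
    intro h0
    rw [Matrix.rank, Submodule.finrank_eq_zero, LinearMap.range_eq_bot] at h0
    apply hψ
    funext i a b c
    classical
    have := congrFun (LinearMap.congr_fun h0 (Pi.single ((i, a), c) 1)) b
    simpa using this
  -- `h1` and `h2` are symmetric in the two ranks. If `|γ| < |κ|`, the one with the larger
  -- (positive) rank on its left side fails.
  by_contra! hlt
  rcases Nat.lt_or_ge G.rank H.rank with h | h <;> nlinarith [Nat.pos_of_ne_zero h4]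

end Tripartite

end Rank

/-! ### Local operators -/

section LocalOp

variable {n q : ℕ}

open scoped Kronecker in
theorem localOp_eq_submatrix_kronecker (S : Finset (Fin n)) (N : SubsystemOp q S) :
    localOp S N = (N ⊗ₖ (1 : Matrix ({i // i ∉ S} → Fin q) ({i // i ∉ S} → Fin q) ℂ)).submatrix
      (Equiv.piEquivPiSubtypeProd (· ∈ S) fun _ => Fin q)
      (Equiv.piEquivPiSubtypeProd (· ∈ S) fun _ => Fin q) := by
  ext x y
  simp [localOp, Matrix.kroneckerMap_apply, Matrix.one_apply, funext_iff,
    Equiv.piEquivPiSubtypeProd]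

theorem localOp_mul (S : Finset (Fin n)) (M N : SubsystemOp q S) :
    localOp S (M * N) = localOp S M * localOp S N := by
  simp only [localOp_eq_submatrix_kronecker, Matrix.submatrix_mul_equiv, ← Matrix.mul_kronecker_mul,
    one_mul]

theorem localOp_one (S : Finset (Fin n)) : localOp S (1 : SubsystemOp q S) = 1 := by
  rw [localOp_eq_submatrix_kronecker, Matrix.one_kronecker_one, Matrix.submatrix_one_equiv]

theorem localOp_conjTranspose (S : Finset (Fin n)) (N : SubsystemOp q S) :
    localOp S N.conjTranspose = (localOp S N).conjTranspose := by
  ext x y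
  simp only [localOp, Matrix.of_apply, Matrix.conjTranspose_apply, eq_comm (a := x _)]
  split_ifs <;> simp

theorem localOp_sum {ι : Type*} (S : Finset (Fin n)) (s : Finset ι) (N : ι → SubsystemOp q S) :
    localOp S (∑ i ∈ s, N i) = ∑ i ∈ s, localOp S (N i) := by
  ext x y
  simp only [localOp, Matrix.of_apply, Matrix.sum_apply]
  split_ifs <;> simp

theorem localOp_mul_localOp_apply {S T : Finset (Fin n)} (h : Disjoint S T) (M : SubsystemOp q S)
    (N : SubsystemOp q T) (x z : Fin n → Fin q) :
    (localOp S M * localOp T N) x z = if ∀ i, i ∉ S → i ∉ T → x i = z i then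
      M (fun i => x i) (fun i => z i) * N (fun i => x i) (fun i => z i) else 0 := by
  have hT {i} (hi : i ∈ T) : i ∉ S := fun hS => Finset.disjoint_left.mp h hS hi
  -- The only intermediate word that can contribute agrees with `z` on `S` and with `x` elsewhere.
  rw [Matrix.mul_apply, Finset.sum_eq_single fun i => if i ∈ S then z i else x i]
  · have h1 : (fun i : T => if (i : Fin n) ∈ S then z i else x i) = fun i : T => x i := by
      funext i
      simp [hT i.2]
    have h2 : (∀ i, i ∉ T → (if i ∈ S then z i else x i) = z i) ↔
        ∀ i, i ∉ S → i ∉ T → x i = z i := by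
      refine forall_congr' fun i => ?_
      by_cases hi : i ∈ S <;> simp [hi]
    simp only [localOp, Matrix.of_apply, h1, h2]
    rw [if_pos (fun i hi => by simp [hi])]
    simp
  · intro y _ hy
    by_contra h0
    simp only [localOp, Matrix.of_apply, mul_eq_zero, not_or, ite_eq_right_iff, not_forall] at h0
    obtain ⟨⟨h1, -⟩, h2, -⟩ := h0
    apply hy
    funext i
    by_cases hi : i ∈ S
    · simpa [hi] using h2 i (fun hiT => hT hiT hi)
    · simpa [hi] using (h1 i hi).symm
  · simp

theorem localOp_mul_comm {S T : Finset (Fin n)} (h : Disjoint S T) (M : SubsystemOp q S)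
    (N : SubsystemOp q T) : localOp S M * localOp T N = localOp T N * localOp S M := by
  ext x z
  rw [localOp_mul_localOp_apply h, localOp_mul_localOp_apply h.symm]
  simp only [mul_comm]
  congr 1
  exact propext ⟨fun H i a b => H i b a, fun H i a b => H i b a⟩

/-- The operator `|u⟩⟨v|` on the qudit `j`. -/
def siteUnit (j : Fin n) (u v : Fin q) : QuditOp n q :=
  localOp {j} (Matrix.of fun x y => if x ⟨j, by simp⟩ = u ∧ y ⟨j, by simp⟩ = v then 1 else 0)

theorem siteUnit_apply (j : Fin n) (u v : Fin q) (x y : Fin n → Fin q) :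
    siteUnit j u v x y = if x j = u ∧ y = Function.update x j v then 1 else 0 := by
  have : (y = Function.update x j v) ↔ y j = v ∧ ∀ i, i ≠ j → x i = y i := by
    rw [Function.eq_update_iff]
    simp only [eq_comm]
  simp only [siteUnit, localOp, Matrix.of_apply, Finset.mem_singleton, this]
  split_ifs <;> grind

theorem siteUnit_conjTranspose (j : Fin n) (u v : Fin q) :
    (siteUnit j u v).conjTranspose = siteUnit j v u := by
  rw [siteUnit, ← localOp_conjTranspose, siteUnit]
  congr 1
  ext x y
  simp only [Matrix.conjTranspose_apply, Matrix.of_apply, and_comm]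
  split_ifs <;> simp

theorem siteUnit_mul_siteUnit (j : Fin n) (u v w : Fin q) :
    siteUnit j u v * siteUnit j v w = siteUnit j u w := by
  ext x y
  rw [Matrix.mul_apply, Finset.sum_eq_single (Function.update x j v)]
  · simp [siteUnit_apply]
    split_ifs <;> grind
  · intro z _ hz
    simp [siteUnit_apply, hz]
  · simp

/-- Kraus form of the loss, so that loss followed by recovery becomes a single Kraus sum. -/
theorem traceOut_eq_sum (j : Fin n) (ρ : QuditOp n q) :
    traceOut j ρ = (q : ℂ)⁻¹ •
      ∑ u, ∑ c, siteUnit j u c * ρ * (siteUnit j u c).conjTranspose := by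
  ext x y
  have h1 (u c : Fin q) : (siteUnit j u c * ρ * (siteUnit j u c).conjTranspose) x y =
      if x j = u ∧ y j = u then ρ (Function.update x j c) (Function.update y j c) else 0 := by
    simp only [Matrix.mul_apply, Matrix.conjTranspose_apply, siteUnit_apply, ite_and]
    by_cases hx : x j = u <;> by_cases hy : y j = u <;> simp [hx, hy]
  simp only [traceOut, Matrix.of_apply, Matrix.smul_apply, Matrix.sum_apply, h1, smul_eq_mul]
  rw [Finset.sum_comm]
  by_cases hxy : x j = y j
  · simp [hxy]
  · have (u : Fin q) : ¬(x j = u ∧ y j = u) := by grind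
    simp [hxy, this]

/-- Operators on `insert j A` decompose over matrix units at `j`. -/
theorem localOp_insert (A : Finset (Fin n)) (j : Fin n) (hj : j ∉ A)
    (N : SubsystemOp q (insert j A : Finset (Fin n))) :
    ∃ M : Fin q → Fin q → SubsystemOp q A,
      localOp (insert j A) N = ∑ u, ∑ v, localOp A (M u v) * siteUnit j u v := by
  let ext (a : A → Fin q) (u : Fin q) : {i // i ∈ insert j A} → Fin q :=
    fun i => if h : (i : Fin n) ∈ A then a ⟨i, h⟩ else u
  refine ⟨fun u v => Matrix.of fun a b => N (ext a u) (ext b v), ?_⟩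
  have hext (x : Fin n → Fin q) : ext (fun i => x i) (x j) = fun i : {i // i ∈ insert j A} => x i := by
    funext i
    by_cases h : (i : Fin n) ∈ A
    · simp [ext, h]
    · have : (i : Fin n) = j := (Finset.mem_insert.mp i.2).resolve_right h
      simp [ext, hj, this]
  funext x z
  have hd : Disjoint A {j} := by simpa using hj
  simp only [Matrix.sum_apply, siteUnit, localOp_mul_localOp_apply hd, Matrix.of_apply,
    Finset.mem_singleton]
  have hc : (∀ i, i ∉ A → i ≠ j → x i = z i) ↔ ∀ i, i ∉ insert j A → x i = z i := by
    simp only [Finset.mem_insert, not_or]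
    exact ⟨fun H i hi => H i hi.2 hi.1, fun H i h1 h2 => H i ⟨h2, h1⟩⟩
  simp only [localOp, Matrix.of_apply, hc]
  split_ifs
  · rw [Finset.sum_eq_single (x j), Finset.sum_eq_single (z j)]
    · simp [hext]
    all_goals simp +contextual [eq_comm]
  · simp

end LocalOp

/-! ### Correctable sets -/

section Correctable

variable {n q : ℕ}

/-- The erasure of the qudits in `S` satisfies the Knill-Laflamme condition for `C`. -/
def Correctable (C : Submodule ℂ (QuditSpace n q)) (S : Finset (Fin n)) : Prop :=
  ∀ N : SubsystemOp q S, ∃ c : ℂ, ∀ φ ∈ C, ∀ ψ ∈ C,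
    inner ℂ φ (Matrix.toEuclideanLin (localOp S N) ψ) = c * inner ℂ φ ψ

theorem inner_toEuclideanLin (X : QuditOp n q) (φ ψ : QuditSpace n q) :
    inner ℂ φ (Matrix.toEuclideanLin X ψ) = ∑ x, ∑ y, star (φ x) * X x y * ψ y := by
  simp only [PiLp.inner_apply, RCLike.inner_apply, Matrix.toLpLin_apply, Matrix.mulVec, dotProduct,
    Finset.sum_mul]
  refine Finset.sum_congr rfl fun x _ => Finset.sum_congr rfl fun y _ => ?_
  simp
  ring

theorem inner_toEuclideanLin_left (X : QuditOp n q) (φ ψ : QuditSpace n q) :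
    inner ℂ (Matrix.toEuclideanLin X φ) ψ =
      inner ℂ φ (Matrix.toEuclideanLin X.conjTranspose ψ) := by
  rw [Matrix.toEuclideanLin_conjTranspose_eq_adjoint, LinearMap.adjoint_inner_right]

theorem toEuclideanLin_mul (X Y : QuditOp n q) (ψ : QuditSpace n q) :
    Matrix.toEuclideanLin (X * Y) ψ = Matrix.toEuclideanLin X (Matrix.toEuclideanLin Y ψ) := by
  simp [Matrix.toLpLin_apply]

/-- A linear map for which every vector of `C` is an eigenvector is scalar on `C`. -/
theorem LinearMap.exists_forall_mem_eq_smul {K V : Type*} [Field K] [AddCommGroup V] [Module K V]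
    (f : V →ₗ[K] V) (C : Submodule K V) (h : ∀ v ∈ C, ∃ c : K, f v = c • v) :
    ∃ c : K, ∀ v ∈ C, f v = c • v := by
  by_cases hC : ∀ v ∈ C, v = 0
  · exact ⟨0, fun v hv => by simp [hC v hv]⟩
  push Not at hC
  obtain ⟨v, hv, hv0⟩ := hC
  obtain ⟨c, hc⟩ := h v hv
  refine ⟨c, fun w hw => ?_⟩
  obtain ⟨a, ha⟩ := h w hw
  obtain ⟨b, hb⟩ := h (v + w) (C.add_mem hv hw)
  rw [map_add, hc, ha] at hb
  have h1 : (a - b) • w = (b - c) • v := by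
    rw [sub_smul, sub_smul]
    rw [smul_add] at hb
    rw [sub_eq_sub_iff_add_eq_add, add_comm, hb, add_comm]
  by_cases hab : a = b
  · rw [hab, sub_self, zero_smul, eq_comm, smul_eq_zero, or_iff_left hv0, sub_eq_zero] at h1
    rw [ha, hab, h1]
  · have h2 : w = ((a - b)⁻¹ * (b - c)) • v := by
      rw [mul_smul, ← h1, inv_smul_smul₀ (sub_ne_zero.mpr hab)]
    rw [h2, map_smul, hc, smul_comm]

theorem conj_pureState (X : QuditOp n q) (ψ : QuditSpace n q) :
    X * pureState ψ * X.conjTranspose = pureState (Matrix.toEuclideanLin X ψ) := by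
  have h (φ : QuditSpace n q) : pureState φ = Matrix.vecMulVec φ (star φ : (Fin n → Fin q) → ℂ) := by
    ext; simp [pureState, Matrix.vecMulVec_apply]
  rw [h, h, Matrix.mul_vecMulVec, Matrix.vecMulVec_mul, ← Matrix.star_mulVec]
  simp [Matrix.toLpLin_apply]

theorem inner_pureState (φ χ : QuditSpace n q) :
    inner ℂ χ (Matrix.toEuclideanLin (pureState φ) χ) = ((‖inner ℂ χ φ‖ ^ 2 : ℝ) : ℂ) := by
  rw [inner_toEuclideanLin, Complex.ofReal_pow, ← Complex.mul_conj', inner_conj_symm,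
    PiLp.inner_apply, PiLp.inner_apply, Finset.sum_mul_sum]
  refine Finset.sum_congr rfl fun x _ => Finset.sum_congr rfl fun y _ => ?_
  simp [pureState]
  ring

/-- Pure states are extremal: for `χ ⟂ ψ` the expectation of the sum in `χ` vanishes and its terms
are nonnegative, so every `φ i` is orthogonal to `χ`. -/
theorem mem_span_of_sum_pureState {ι : Type*} (s : Finset ι) (c : ℝ) (hc : c ≠ 0)
    (φ : ι → QuditSpace n q) (ψ : QuditSpace n q)
    (h : (c : ℂ) • ∑ i ∈ s, pureState (φ i) = pureState ψ) (i : ι) (hi : i ∈ s) :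
    ∃ a : ℂ, φ i = a • ψ := by
  have h1 : φ i ∈ (ℂ ∙ ψ)ᗮᗮ := by
    rw [Submodule.mem_orthogonal]
    intro χ hχ
    rw [Submodule.mem_orthogonal_singleton_iff_inner_left] at hχ
    have h2 := congrArg (fun X => inner ℂ χ (Matrix.toEuclideanLin X χ)) h
    simp only [map_smul, map_sum, LinearMap.smul_apply, LinearMap.sum_apply, inner_smul_right,
      inner_sum, inner_pureState, hχ] at h2
    rw [← Complex.ofReal_sum, ← Complex.ofReal_mul, Complex.ofReal_inj] at h2
    simp only [norm_zero, ne_eq, OfNat.ofNat_ne_zero, not_false_eq_true, zero_pow, mul_eq_zero, hc,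
      false_or] at h2
    rw [Finset.sum_eq_zero_iff_of_nonneg (fun _ _ => by positivity)] at h2
    simpa using h2 i hi
  rw [Submodule.orthogonal_orthogonal, Submodule.mem_span_singleton] at h1
  exact h1.imp fun a ha => ha.symm

theorem LocalChannel.apply_traceOut {S : Finset (Fin n)} (R : LocalChannel q S) (j : Fin n)
    (ψ : QuditSpace n q) :
    R.apply (traceOut j (pureState ψ)) = (((q : ℝ)⁻¹ : ℝ) : ℂ) •
      ∑ a : Fin R.size × Fin q × Fin q, pureState (Matrix.toEuclideanLin
        (localOp S (R.kraus a.1) * siteUnit j a.2.1 a.2.2) ψ) := by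
  simp only [LocalChannel.apply, traceOut_eq_sum, Fintype.sum_prod_type, ← conj_pureState,
    Matrix.conjTranspose_mul, Matrix.mul_smul, Matrix.smul_mul, Finset.smul_sum, Finset.mul_sum,
    Finset.sum_mul, Matrix.mul_assoc]
  push_cast
  rfl

/-- The operators `K F`, with `K` a Kraus operator of a recovery channel and `F` a matrix unit at
the lost qudit, are scalar on the code. -/
theorem exists_scalar_of_recovery (hq : 2 ≤ q) {C : Submodule ℂ (QuditSpace n q)}
    {S : Finset (Fin n)} (R : LocalChannel q S) (j : Fin n)
    (hR : ∀ ψ ∈ C, ‖ψ‖ = 1 → R.apply (traceOut j (pureState ψ)) = pureState ψ)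
    (a : Fin R.size) (u v : Fin q) :
    ∃ c : ℂ, ∀ ψ ∈ C,
      Matrix.toEuclideanLin (localOp S (R.kraus a) * siteUnit j u v) ψ = c • ψ := by
  -- Purity of the recovered state gives a scalar that might depend on `ψ`; linearity makes it
  -- uniform.
  apply LinearMap.exists_forall_mem_eq_smul
  intro ψ hψ
  by_cases h0 : ψ = 0
  · exact ⟨0, by simp [h0]⟩
  have hn : (‖ψ‖ : ℂ) ≠ 0 := by simpa using h0
  have h1 := hR ((‖ψ‖ : ℂ)⁻¹ • ψ) (C.smul_mem _ hψ) (by simp [norm_smul, h0])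
  rw [R.apply_traceOut] at h1
  obtain ⟨c, hc⟩ := mem_span_of_sum_pureState _ _ (by simp; omega) _ _ h1 (a, u, v) (by simp)
  refine ⟨c, ?_⟩
  rw [map_smul, smul_comm] at hc
  exact smul_right_injective _ (inv_ne_zero hn) hc

/-- If the erasure of `A` is correctable and the qudit `j` can be recovered from a set that does
not meet `A`, then the erasure of `insert j A` is correctable. -/
theorem Correctable.insert (hq : 2 ≤ q) {C : Submodule ℂ (QuditSpace n q)} {A S : Finset (Fin n)}
    (hA : Correctable C A) {j : Fin n} (hjS : j ∈ S) (hSA : Disjoint A S) (R : LocalChannel q S)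
    (hR : ∀ ψ ∈ C, ‖ψ‖ = 1 → R.apply (traceOut j (pureState ψ)) = pureState ψ) :
    Correctable C (insert j A) := by
  have hjA : j ∉ A := fun h => Finset.disjoint_left.mp hSA h hjS
  have hd : Disjoint A {j} := by simpa using hjA
  intro N
  obtain ⟨M, hM⟩ := localOp_insert A j hjA N
  choose c hc using exists_scalar_of_recovery hq R j hR
  choose m hm using fun u v => hA (M u v)
  -- Insert `∑ K† K = 1`, moving `K†` past the operator on `A`, which is disjoint from `S`. The
  -- outer factors `K F` are scalar on the code, which leaves the Knill-Laflamme condition for `A`.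
  have key (u v : Fin q) : localOp A (M u v) * siteUnit j u v =
      ∑ a, (localOp S (R.kraus a) * siteUnit j u u).conjTranspose * localOp A (M u v) *
        (localOp S (R.kraus a) * siteUnit j u v) := by
    have h1 (a : Fin R.size) : (localOp S (R.kraus a) * siteUnit j u u).conjTranspose *
        localOp A (M u v) * (localOp S (R.kraus a) * siteUnit j u v) =
        siteUnit j u u * localOp A (M u v) *
          localOp S ((R.kraus a).conjTranspose * R.kraus a) * siteUnit j u v := by
      rw [Matrix.conjTranspose_mul, siteUnit_conjTranspose, localOp_mul, ← localOp_conjTranspose,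
        Matrix.mul_assoc (siteUnit j u u), ← localOp_mul_comm hSA]
      simp only [Matrix.mul_assoc]
    simp only [h1]
    rw [← Finset.sum_mul, ← Finset.mul_sum, ← localOp_sum, R.trace_preserving, localOp_one, mul_one]
    conv_rhs => rw [siteUnit, ← localOp_mul_comm hd, mul_assoc, ← siteUnit, siteUnit_mul_siteUnit]
  refine ⟨∑ u, ∑ v, ∑ a, star (c a u u) * c a u v * m u v, fun φ hφ ψ hψ => ?_⟩
  simp only [hM, key, map_sum, LinearMap.sum_apply, inner_sum, Finset.sum_mul]
  refine Finset.sum_congr rfl fun u _ => Finset.sum_congr rfl fun v _ =>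
    Finset.sum_congr rfl fun a _ => ?_
  rw [mul_assoc, toEuclideanLin_mul, toEuclideanLin_mul, ← inner_toEuclideanLin_left, hc _ _ _ φ hφ,
    hc _ _ _ ψ hψ, map_smul, inner_smul_left, inner_smul_right, hm _ _ φ hφ ψ hψ]
  simp
  ring

end Correctable

/-! ### Counting erasure patterns and recovery orders -/

section Counting

variable {n : ℕ}

/-- In a uniformly random order of `Fin n`, each element of `B` is the last one of `B` with
probability `1 / |B|`. -/
theorem card_filter_last_mul_card (B : Finset (Fin n)) (j : Fin n) (hj : j ∈ B) :
    ({σ : Equiv.Perm (Fin n) | ∀ i ∈ B, σ i ≤ σ j} : Finset _).card * B.card = n.factorial := by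
  let P (k : Fin n) : Finset (Equiv.Perm (Fin n)) := {σ | ∀ i ∈ B, σ i ≤ σ k}
  have h1 (k) (hk : k ∈ B) : (P k).card = (P j).card := by
    -- Exchanging `j` and `k` preserves `B` and matches the orders with `k` last to those with `j`
    -- last.
    refine Finset.card_equiv (Equiv.mulRight (Equiv.swap j k)) fun σ => ?_
    have hs (i) (hi : i ∈ B) : Equiv.swap j k i ∈ B := by
      rw [Equiv.swap_apply_def]; split_ifs <;> assumption
    simp only [P, Finset.mem_filter, Finset.mem_univ, true_and, Equiv.coe_mulRight,
      Equiv.Perm.mul_apply, Equiv.swap_apply_left]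
    refine ⟨fun h i hi => h _ (hs i hi), fun h i hi => ?_⟩
    simpa using h _ (hs i hi)
  have h2 : B.biUnion P = Finset.univ := by
    refine Finset.eq_univ_iff_forall.mpr fun σ => ?_
    obtain ⟨k, hk, h⟩ := B.exists_max_image σ ⟨j, hj⟩
    exact Finset.mem_biUnion.mpr ⟨k, hk, by simpa [P] using h⟩
  have h3 : (B.biUnion P).card = ∑ k ∈ B, (P k).card := by
    refine Finset.card_biUnion fun k hk l hl hkl => Finset.disjoint_left.mpr fun σ h h' => hkl ?_
    simp only [P, Finset.mem_filter, Finset.mem_univ, true_and] at h h'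
    exact σ.injective (le_antisymm (h' k hk) (h l hl))
  rw [h2, Finset.sum_congr rfl h1, Finset.sum_const, Finset.card_univ, Fintype.card_perm,
    Fintype.card_fin, smul_eq_mul] at h3
  rw [h3, mul_comm]

theorem card_filter_disjoint_powersetCard (M B : Finset (Fin n)) (hB : B ⊆ M) (e : ℕ) :
    ((M.powersetCard e).filter (Disjoint · B)).card = (M.card - B.card).choose e := by
  rw [← Finset.card_sdiff_of_subset hB, ← Finset.card_powersetCard]
  congr 1
  ext E
  simp only [Finset.mem_filter, Finset.mem_powersetCard, Finset.subset_sdiff]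
  tauto

/-- The pairs of an erasure pattern of size `e` in `M` and an order for which `B` is not touched
by the erasure and `j` is last in `B`. -/
def goodPairs (M : Finset (Fin n)) (e : ℕ) (j : Fin n) (B : Finset (Fin n)) :
    Finset (Finset (Fin n) × Equiv.Perm (Fin n)) :=
  (M.powersetCard e).filter (Disjoint · B) ×ˢ
    ({σ : Equiv.Perm (Fin n) | ∀ i ∈ B, σ i ≤ σ j} : Finset _)

theorem mem_goodPairs {M : Finset (Fin n)} {e : ℕ} {j : Fin n} {B : Finset (Fin n)}
    {x : Finset (Fin n) × Equiv.Perm (Fin n)} : x ∈ goodPairs M e j B ↔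
      x.1 ∈ M.powersetCard e ∧ Disjoint x.1 B ∧ ∀ i ∈ B, x.2 i ≤ x.2 j := by
  simp [goodPairs, and_assoc]

theorem goodPairs_anti (M : Finset (Fin n)) (e : ℕ) (j : Fin n) {B B' : Finset (Fin n)}
    (h : B ⊆ B') : goodPairs M e j B' ⊆ goodPairs M e j B := fun x => by
  simp only [mem_goodPairs]
  exact fun ⟨h1, h2, h3⟩ => ⟨h1, h2.mono_right h, fun i hi => h3 i (h hi)⟩

theorem card_goodPairs (M B : Finset (Fin n)) (e : ℕ) (j : Fin n) (hB : B ⊆ M) (hj : j ∈ B) :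
    ((goodPairs M e j B).card : ℚ) =
      n.factorial * (binom ((M.card : ℤ) - B.card) e * (1 / (B.card : ℚ))) := by
  have hB0 : (B.card : ℚ) ≠ 0 := by
    exact_mod_cast (Finset.card_pos.mpr ⟨j, hj⟩).ne'
  have hle := Finset.card_le_card hB
  have hb : binom ((M.card : ℤ) - B.card) e = ((M.card - B.card).choose e : ℕ) := by
    rw [binom, ← Nat.cast_sub hle, Int.toNat_natCast]
    split_ifs with h
    · rw [Nat.choose_eq_zero_of_lt (by exact_mod_cast h), Nat.cast_zero]
    · rfl
  rw [goodPairs, Finset.card_product, card_filter_disjoint_powersetCard M B hB, hb,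
    ← card_filter_last_mul_card B j hj]
  push_cast
  field_simp

/-- Avoiding `E` and preceding `j` are conditions on single elements, so imposing them on several
sets is imposing them on the union. -/
theorem biUnion_goodPairs_inter {T : Type*} [DecidableEq T] (M : Finset (Fin n)) (e : ℕ) (j : Fin n)
    (A : T → Finset (Fin n)) (I : Finset T) (hI : I.Nonempty) :
    I.inf' hI (fun l => goodPairs M e j (A l)) = goodPairs M e j (I.biUnion A) := by
  ext x
  have : x ∈ I.inf' hI (fun l => goodPairs M e j (A l)) ↔ ∀ l ∈ I, x ∈ goodPairs M e j (A l) := by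
    rw [← Finset.singleton_subset_iff]
    exact (Finset.le_inf'_iff hI _).trans (by simp)
  rw [this]
  simp only [mem_goodPairs, Finset.disjoint_biUnion_right, Finset.mem_biUnion]
  obtain ⟨l, hl⟩ := hI
  constructor
  · intro h
    exact ⟨(h l hl).1, fun l hl => (h l hl).2.1, fun i ⟨l, hl, hi⟩ => (h l hl).2.2 i hi⟩
  · exact fun ⟨h1, h2, h3⟩ l hl => ⟨h1, h2 l hl, fun i hi => h3 i ⟨l, hl, hi⟩⟩

/-- Inclusion-exclusion for sets whose unions have prescribed sizes. -/
theorem card_biUnion_goodPairs {T : Type*} [DecidableEq T] (M : Finset (Fin n)) (e r s : ℕ)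
    (j : Fin n) (A : T → Finset (Fin n)) (Λ : Finset T) (hj : ∀ l ∈ Λ, j ∈ A l)
    (hM : ∀ l ∈ Λ, A l ⊆ M)
    (hcard : ∀ I ⊆ Λ, I.Nonempty → ((I.biUnion A).card : ℤ) = unionSize r I.card s)
    (he : e ≤ M.card) :
    ((Λ.biUnion fun l => goodPairs M e j (A l)).card : ℚ) =
      n.factorial * M.card.choose e * fTilde M.card e r Λ.card s := by
  have hC : binom M.card e = (M.card.choose e : ℚ) := by
    rw [binom, if_neg (by omega), Int.toNat_natCast]
  have hC0 : (M.card.choose e : ℚ) ≠ 0 := by exact_mod_cast (Nat.choose_pos he).ne'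
  let g (L : ℕ) : ℚ := (-1) ^ (L + 1) *
    (n.factorial * (binom ((M.card : ℤ) - unionSize r L s) e * (1 / (unionSize r L s : ℚ))))
  have h1 : ((Λ.biUnion fun l => goodPairs M e j (A l)).card : ℚ) =
      ∑ I ∈ Λ.powerset with I.Nonempty, g I.card := by
    have h := congrArg (Int.cast : ℤ → ℚ)
      (Finset.inclusion_exclusion_card_biUnion Λ fun l => goodPairs M e j (A l))
    rw [Int.cast_natCast] at h
    rw [h, ← Finset.sum_coe_sort (Λ.powerset.filter (·.Nonempty)) fun I => g I.card]
    push_cast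
    refine Finset.sum_congr rfl fun I _ => ?_
    obtain ⟨hIΛ, hI⟩ := Finset.mem_filter.mp I.2
    rw [Finset.mem_powerset] at hIΛ
    rw [biUnion_goodPairs_inter, card_goodPairs M _ e j]
    · have := hcard I hIΛ hI
      simp only [g, ← this, Int.cast_natCast]
    · exact Finset.biUnion_subset.mpr fun l hl => hM l (hIΛ hl)
    · obtain ⟨l, hl⟩ := hI
      exact Finset.mem_biUnion.mpr ⟨l, hl, hj l (hIΛ hl)⟩
  have h2 : ∑ I ∈ Λ.powerset with I.Nonempty, g I.card =
      ∑ L ∈ Finset.Icc 1 Λ.card, Λ.card.choose L * g L := by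
    -- Giving the empty set the value `0` allows the whole powerset to be grouped by cardinality.
    have h3 (I : Finset T) : (if I.Nonempty then g I.card else 0) =
        (fun L => if L = 0 then 0 else g L) I.card := by
      rcases I.eq_empty_or_nonempty with rfl | hI
      · simp
      · simp [hI, hI.ne_empty]
    rw [Finset.sum_filter]
    simp only [h3]
    rw [Finset.sum_powerset_apply_card (fun L => if L = 0 then 0 else g L),
      Finset.sum_range_succ', Finset.range_eq_Ico, Finset.sum_Ico_add' (fun L =>
        Λ.card.choose L • if L = 0 then 0 else g L) 0 Λ.card 1]
    simp only [if_true, smul_zero, add_zero, zero_add]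
    refine Finset.sum_congr (by ext; simp) fun L hL => ?_
    rw [if_neg (by simp at hL; omega), nsmul_eq_mul]
  rw [h1, h2, fTilde, Finset.mul_sum]
  refine Finset.sum_congr rfl fun L _ => ?_
  rw [hC]
  simp only [g]
  field_simp

end Counting

/-! ### Sizes of unions of recovery sets and the averaging argument. -/

section ExactCondition

variable {n t : ℕ}

/-- Since triple intersections are empty, a new set meets the union of the earlier ones in `|I|`
disjoint pieces of size `s`. It is applied to the recovery sets with `j` removed. -/
theorem two_mul_card_biUnion {T α : Type*} [DecidableEq T] [DecidableEq α] (B : T → Finset α)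
    (r s : ℕ) (h1 : ∀ l, (B l).card = r)
    (h2 : ∀ l₁ l₂, l₁ ≠ l₂ → (B l₁ ∩ B l₂).card = s)
    (h3 : ∀ l₁ l₂ l₃, l₁ ≠ l₂ → l₁ ≠ l₃ → l₂ ≠ l₃ → B l₁ ∩ B l₂ ∩ B l₃ = ∅) (I : Finset T) :
    2 * ((I.biUnion B).card : ℤ) = (2 * (r : ℤ) - ((I.card : ℤ) - 1) * s) * I.card := by
  induction I using Finset.induction_on with
  | empty => simp
  | insert a I ha ih =>
    have hne {i} (hi : i ∈ I) : a ≠ i := fun h => ha (h ▸ hi)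
    have hint : (B a ∩ I.biUnion B).card = I.card * s := by
      rw [Finset.inter_biUnion, Finset.card_biUnion, Finset.sum_const_nat]
      · exact fun i hi => h2 a i (hne hi)
      · intro i hi k hk hik
        have := h3 a i k (hne hi) (hne hk) hik
        rw [Function.onFun, Finset.disjoint_iff_inter_eq_empty, ← this]
        ext
        simp only [Finset.mem_inter]
        tauto
    have hu := Finset.card_union_add_card_inter (B a) (I.biUnion B)
    rw [← Finset.biUnion_insert, hint, h1] at hu
    rw [Finset.card_insert_of_notMem ha]
    have hu' : (((insert a I).biUnion B).card : ℤ) + I.card * s = r + (I.biUnion B).card := by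
      exact_mod_cast hu
    push_cast
    linear_combination 2 * hu' + ih

/-- For `I = ∅` this would fail: `unionSize` is then `1`, because it always counts the common point
`j`. -/
theorem ExactCondition.card_biUnion {r s : ℕ} {Γ : Fin t → Fin n → Finset (Fin n)}
    (hΓ : ExactCondition r s Γ) (j : Fin n) (I : Finset (Fin t)) (hI : I.Nonempty) :
    ((I.biUnion fun l => Γ l j).card : ℤ) = unionSize r I.card s := by
  have erase_inter (X Y : Finset (Fin n)) : (X ∩ Y).erase j = X.erase j ∩ Y.erase j := by
    ext
    simp only [Finset.mem_inter, Finset.mem_erase]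
    tauto
  have h := two_mul_card_biUnion (fun l => (Γ l j).erase j) r s
    (fun l => by rw [Finset.card_erase_of_mem (hΓ.mem l j), hΓ.card, Nat.add_sub_cancel])
    (fun l₁ l₂ hl => by
      rw [← erase_inter, Finset.card_erase_of_mem, hΓ.card_inter j l₁ l₂ hl,
        Nat.add_sub_cancel]
      simp [hΓ.mem])
    (fun l₁ l₂ l₃ h12 h13 h23 => by
      rw [← erase_inter, ← erase_inter,
        hΓ.inter_three j l₁ l₂ l₃ h12 h13 h23, Finset.erase_singleton]) I
  have hU : I.biUnion (fun l => Γ l j) = insert j (I.biUnion fun l => (Γ l j).erase j) := by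
    obtain ⟨l, hl⟩ := hI
    ext i
    simp only [Finset.mem_biUnion, Finset.mem_insert, Finset.mem_erase]
    by_cases hij : i = j
    · subst hij
      simpa using ⟨l, hl, hΓ.mem l i⟩
    · simp [hij]
  rw [hU, Finset.card_insert_of_notMem (by simp), unionSize, ← h]
  push_cast
  omega

/-- A set `U` with `|U| ≤ |M|` can be moved into `M` without moving the points of `U ∩ M`. -/
theorem exists_injOn_mapsTo_fix {α : Type*} [DecidableEq α] (U M : Finset α)
    (h : U.card ≤ M.card) : ∃ f : α → α, Set.InjOn f U ∧ (∀ x ∈ U, f x ∈ M) ∧ ∀ x ∈ M, f x = x := by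
  have hc : (U \ M).card ≤ (M \ U).card := Finset.card_sdiff_le_card_sdiff_iff.mpr h
  obtain ⟨g⟩ := Function.Embedding.nonempty_of_card_le
    (α := {x // x ∈ U \ M}) (β := {x // x ∈ M \ U}) (by simpa using hc)
  have hg (x) := Finset.mem_sdiff.mp (g x).2
  refine ⟨fun x => if h : x ∈ U \ M then g ⟨x, h⟩ else x, fun x hx y hy hxy => ?_,
    fun x hx => ?_, fun x hx => by simp [hx]⟩
  · dsimp only at hxy
    split_ifs at hxy with h1 h2 h2
    · simpa using g.injective (Subtype.ext hxy)
    · exact absurd (hxy ▸ hy) (hg _).2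
    · exact absurd (hxy ▸ hx) (hg _).2
    · exact hxy
  · dsimp only
    split_ifs with h1
    · exact (hg _).1
    · by_contra h2
      exact h1 (Finset.mem_sdiff.mpr ⟨hx, h2⟩)

/-- The truncated sets `Γ l j ∩ M` have no prescribed union sizes. Moving the whole union
injectively into `M`, with the points of `M` fixed, yields larger sets with the right sizes; larger
sets have fewer good pairs, so their exact count is a lower bound. -/
theorem ExactCondition.le_card_biUnion_goodPairs {r s : ℕ} {Γ : Fin t → Fin n → Finset (Fin n)}
    (hΓ : ExactCondition r s Γ) (M : Finset (Fin n)) (e : ℕ) (he : e ≤ M.card) (j : Fin n)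
    (hj : j ∈ M) (Λ : Finset (Fin t)) (hΛ : unionSize r Λ.card s ≤ M.card) :
    (n.factorial * M.card.choose e * fTilde M.card e r Λ.card s : ℚ) ≤
      (Λ.biUnion fun l => goodPairs M e j (Γ l j ∩ M)).card := by
  have hU : (Λ.biUnion fun l => Γ l j).card ≤ M.card := by
    rcases Λ.eq_empty_or_nonempty with rfl | hne
    · simp
    · have := hΓ.card_biUnion j Λ hne
      omega
  obtain ⟨f, hf, hfM, hfix⟩ := exists_injOn_mapsTo_fix _ M hU
  have hsub {l} (hl : l ∈ Λ) : Γ l j ⊆ Λ.biUnion fun l => Γ l j :=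
    Finset.subset_biUnion_of_mem (fun l => Γ l j) hl
  rw [← card_biUnion_goodPairs M e r s j (fun l => (Γ l j).image f) Λ _ _ _ he]
  · refine Nat.cast_le.mpr (Finset.card_le_card (Finset.biUnion_mono fun l hl =>
      goodPairs_anti M e j fun i hi => ?_))
    obtain ⟨h1, h2⟩ := Finset.mem_inter.mp hi
    exact Finset.mem_image.mpr ⟨i, h1, hfix i h2⟩
  · exact fun l hl => Finset.mem_image.mpr ⟨j, hΓ.mem l j, hfix j hj⟩
  · exact fun l hl => Finset.image_subset_iff.mpr fun i hi => hfM i (hsub hl hi)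
  · intro I hI hne
    rw [← hΓ.card_biUnion j I hne, ← Finset.biUnion_image, Finset.card_image_of_injOn]
    exact hf.mono (by exact_mod_cast Finset.biUnion_subset_biUnion_of_subset_left _ hI)

/-- Some erasure of size `e` inside `M` leaves many qudits of `M` that can be recovered one after
the other, from the qudits outside `M` and earlier qudits of `M`. -/
theorem ExactCondition.exists_erasure_of_index {r s : ℕ} {Γ : Fin t → Fin n → Finset (Fin n)}
    (hΓ : ExactCondition r s Γ) (M : Finset (Fin n)) (e : ℕ) (he : e ≤ M.card) (T : ℕ) (hT : T ≤ t)
    (hTM : unionSize r T s ≤ M.card) :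
    ∃ E ⊆ M, E.card = e ∧ ∃ J ⊆ M, J.card = ⌈(M.card : ℚ) * fTilde M.card e r T s⌉₊ ∧
      ∃ σ : Equiv.Perm (Fin n), ∀ j ∈ J, ∃ l, Disjoint E (Γ l j) ∧
        ∀ i ∈ Γ l j, i ∈ M → σ i ≤ σ j := by
  obtain ⟨Λ, rfl⟩ : ∃ Λ : Finset (Fin t), Λ.card = T := by
    obtain ⟨Λ, -, h⟩ := Finset.exists_subset_card_eq (s := (Finset.univ : Finset (Fin t)))
      (by simpa using hT)
    exact ⟨Λ, h⟩
  let X : Finset (Finset (Fin n) × Equiv.Perm (Fin n)) := M.powersetCard e ×ˢ Finset.univ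
  let ρ (x : Finset (Fin n) × Equiv.Perm (Fin n)) (j : Fin n) : Prop :=
    x ∈ Λ.biUnion fun l => goodPairs M e j (Γ l j ∩ M)
  have hX : X.Nonempty := (Finset.powersetCard_nonempty.mpr he).product Finset.univ_nonempty
  have hXc : (X.card : ℚ) = n.factorial * M.card.choose e := by
    simp [X, Fintype.card_perm, mul_comm]
  -- Double count the triples of an erasure, an order and a good qudit `j ∈ M`; some pair does at
  -- least as well as the average.
  have hsum : ∑ x ∈ X, ((M.card : ℚ) * fTilde M.card e r Λ.card s) ≤
      ∑ x ∈ X, ((M.bipartiteAbove ρ x).card : ℚ) := by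
    rw [← Nat.cast_sum, Finset.sum_card_bipartiteAbove_eq_sum_card_bipartiteBelow, Nat.cast_sum,
      Finset.sum_const, nsmul_eq_mul, hXc]
    have hb (j) (hj : j ∈ M) : (n.factorial * M.card.choose e * fTilde M.card e r Λ.card s : ℚ) ≤
        ((X.bipartiteBelow ρ j).card : ℚ) := by
      refine (hΓ.le_card_biUnion_goodPairs M e he j hj Λ hTM).trans
        (Nat.cast_le.mpr (Finset.card_le_card fun x hx => ?_))
      refine Finset.mem_filter.mpr ⟨?_, hx⟩
      obtain ⟨l, -, h⟩ := Finset.mem_biUnion.mp hx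
      exact Finset.mem_product.mpr ⟨(mem_goodPairs.mp h).1, Finset.mem_univ _⟩
    have := Finset.card_nsmul_le_sum M _ _ hb
    rw [nsmul_eq_mul] at this
    linarith
  obtain ⟨⟨E, σ⟩, hx, hle⟩ := Finset.exists_le_of_sum_le hX hsum
  obtain ⟨hE, -⟩ := Finset.mem_product.mp hx
  obtain ⟨hEM, hEc⟩ := Finset.mem_powersetCard.mp hE
  obtain ⟨J, hJ, hJc⟩ := Finset.exists_subset_card_eq (Nat.ceil_le.mpr hle)
  refine ⟨E, hEM, hEc, J, hJ.trans (Finset.filter_subset _ _), hJc, σ, fun j hj => ?_⟩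
  obtain ⟨l, -, hl⟩ := Finset.mem_biUnion.mp (Finset.mem_filter.mp (hJ hj)).2
  obtain ⟨-, h1, h2⟩ := mem_goodPairs.mp hl
  refine ⟨l, Finset.disjoint_left.mpr fun i hi hi' => ?_, fun i hi hiM =>
    h2 i (Finset.mem_inter.mpr ⟨hi, hiM⟩)⟩
  exact Finset.disjoint_left.mp h1 hi (Finset.mem_inter.mpr ⟨hi', hEM hi⟩)

theorem ExactCondition.exists_erasure {r s : ℕ} {Γ : Fin t → Fin n → Finset (Fin n)}
    (hΓ : ExactCondition r s Γ) (M : Finset (Fin n)) (e : ℕ) (he : e ≤ M.card) :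
    ∃ E ⊆ M, E.card = e ∧ ∃ J ⊆ M, J.card = calN₁ M.card e r t s ∧
      ∃ σ : Equiv.Perm (Fin n), ∀ j ∈ J, ∃ l, Disjoint E (Γ l j) ∧
        ∀ i ∈ Γ l j, i ∈ M → σ i ≤ σ j := by
  rw [calN₁]
  -- `unionSize r 0 s = 1`, so no index is admissible only if `M` is empty; the supremum is then `0`
  -- and `J = ∅` works.
  rcases Finset.eq_empty_or_nonempty
    ((Finset.range (t + 1)).filter fun T => unionSize r T s ≤ (M.card : ℤ)) with h0 | hne
  · obtain ⟨E, hE, hEc⟩ := Finset.exists_subset_card_eq he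
    exact ⟨E, hE, hEc, ∅, by simp, by simp [h0], 1, by simp⟩
  · obtain ⟨T, hT, hsup⟩ := Finset.exists_mem_eq_sup _ hne
      fun T => ⌈((M.card : ℤ) : ℚ) * fTilde M.card e r T s⌉₊
    obtain ⟨hTt, hTM⟩ := Finset.mem_filter.mp hT
    rw [hsup, Int.cast_natCast]
    exact hΓ.exists_erasure_of_index M e he T (by simpa [Nat.lt_succ_iff] using hTt) hTM

end ExactCondition

/-! ### The Singleton bound for two disjoint correctable sets. -/

section Singleton

variable {n q : ℕ}

/-- Words on `Fin n`, split along two disjoint sets and the rest. -/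
def splitWords (q : ℕ) {A B : Finset (Fin n)} (h : Disjoint A B) : (Fin n → Fin q) ≃
    (A → Fin q) × (B → Fin q) × ({i // i ∈ (A ∪ B)ᶜ} → Fin q) where
  toFun x := (fun i => x i, fun i => x i, fun i => x i)
  invFun y i := if hA : i ∈ A then y.1 ⟨i, hA⟩ else if hB : i ∈ B then y.2.1 ⟨i, hB⟩ else
    y.2.2 ⟨i, by simp [hA, hB]⟩
  left_inv x := by
    funext i
    dsimp only
    split_ifs <;> rfl
  right_inv y := by
    obtain ⟨a, b, c⟩ := y
    refine Prod.ext (funext fun i => ?_) (Prod.ext (funext fun i => ?_) (funext fun i => ?_))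
    · simp
    · have : (i : Fin n) ∉ A := fun hA => Finset.disjoint_left.mp h hA i.2
      simp [this]
    · have := i.2
      rw [Finset.mem_compl, Finset.mem_union, not_or] at this
      simp [this]

theorem splitWords_eq_iff {A B : Finset (Fin n)} {h : Disjoint A B} {x : Fin n → Fin q}
    {a : A → Fin q} {b : B → Fin q} {c : {i // i ∈ (A ∪ B)ᶜ} → Fin q} :
    splitWords q h x = (a, b, c) ↔ (fun i : A => x i) = a ∧ (fun i : B => x i) = b ∧
      (fun i : {i // i ∈ (A ∪ B)ᶜ} => x i) = c := by
  simp only [splitWords, Equiv.coe_fn_mk, Prod.mk.injEq]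

theorem localOp_splitWords_left {A B : Finset (Fin n)} (h : Disjoint A B) (N : SubsystemOp q A)
    (a a' : A → Fin q) (b b' : B → Fin q) (c c' : {i // i ∈ (A ∪ B)ᶜ} → Fin q) :
    localOp A N ((splitWords q h).symm (a, b, c)) ((splitWords q h).symm (a', b', c')) =
      if b = b' ∧ c = c' then N a a' else 0 := by
  obtain ⟨x, hx⟩ := (splitWords q h).surjective (a, b, c)
  obtain ⟨x', hx'⟩ := (splitWords q h).surjective (a', b', c')
  rw [← hx, ← hx', Equiv.symm_apply_apply, Equiv.symm_apply_apply]
  obtain ⟨rfl, rfl, rfl⟩ := splitWords_eq_iff.mp hx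
  obtain ⟨rfl, rfl, rfl⟩ := splitWords_eq_iff.mp hx'
  simp only [localOp, Matrix.of_apply]
  congr 1
  refine propext ⟨fun H => ⟨funext fun i => H i fun hA => Finset.disjoint_left.mp h hA i.2,
    funext fun i => H i ?_⟩, fun H i hi => ?_⟩
  · have := i.2
    rw [Finset.mem_compl, Finset.mem_union, not_or] at this
    exact this.1
  · by_cases hB : i ∈ B
    · exact congrFun H.1 ⟨i, hB⟩
    · exact congrFun H.2 ⟨i, by simp [hi, hB]⟩

theorem localOp_splitWords_right {A B : Finset (Fin n)} (h : Disjoint A B) (N : SubsystemOp q B)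
    (a a' : A → Fin q) (b b' : B → Fin q) (c c' : {i // i ∈ (A ∪ B)ᶜ} → Fin q) :
    localOp B N ((splitWords q h).symm (a, b, c)) ((splitWords q h).symm (a', b', c')) =
      if a = a' ∧ c = c' then N b b' else 0 := by
  obtain ⟨x, hx⟩ := (splitWords q h).surjective (a, b, c)
  obtain ⟨x', hx'⟩ := (splitWords q h).surjective (a', b', c')
  rw [← hx, ← hx', Equiv.symm_apply_apply, Equiv.symm_apply_apply]
  obtain ⟨rfl, rfl, rfl⟩ := splitWords_eq_iff.mp hx
  obtain ⟨rfl, rfl, rfl⟩ := splitWords_eq_iff.mp hx'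
  simp only [localOp, Matrix.of_apply]
  congr 1
  refine propext ⟨fun H => ⟨funext fun i => H i fun hB => Finset.disjoint_left.mp h i.2 hB,
    funext fun i => H i ?_⟩, fun H i hi => ?_⟩
  · have := i.2
    rw [Finset.mem_compl, Finset.mem_union, not_or] at this
    exact this.2
  · by_cases hA : i ∈ A
    · exact congrFun H.1 ⟨i, hA⟩
    · exact congrFun H.2 ⟨i, by simp [hi, hA]⟩

theorem inner_splitWords {A B : Finset (Fin n)} (h : Disjoint A B) (X : QuditOp n q)
    (φ ψ : QuditSpace n q) : inner ℂ φ (Matrix.toEuclideanLin X ψ) =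
      ∑ a, ∑ b, ∑ c, ∑ a', ∑ b', ∑ c', star (φ ((splitWords q h).symm (a, b, c))) *
        X ((splitWords q h).symm (a, b, c)) ((splitWords q h).symm (a', b', c')) *
          ψ ((splitWords q h).symm (a', b', c')) := by
  rw [inner_toEuclideanLin]
  simp only [← (splitWords q h).symm.sum_comp, Fintype.sum_prod_type]

/-- The quantum Singleton bound for two disjoint correctable erasures. -/
theorem finrank_le_of_correctable (C : Submodule ℂ (QuditSpace n q)) {A B : Finset (Fin n)}
    (h : Disjoint A B) (hA : Correctable C A) (hB : Correctable C B) :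
    Module.finrank ℂ C ≤ q ^ ((A ∪ B)ᶜ).card := by
  rcases Nat.eq_zero_or_pos (Module.finrank ℂ C) with h0 | h0
  · simp [h0]
  let v := stdOrthonormalBasis ℂ C
  let ψ : Fin (Module.finrank ℂ C) → (A → Fin q) → (B → Fin q) →
    ({i // i ∈ (A ∪ B)ᶜ} → Fin q) → ℂ :=
    fun i a b c => (v i : QuditSpace n q) ((splitWords q h).symm (a, b, c))
  have hv (i i') : inner ℂ (v i' : QuditSpace n q) (v i : QuditSpace n q) =
      if i = i' then (1 : ℂ) else 0 := by
    have := orthonormal_iff_ite.mp v.orthonormal i' i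
    simpa [eq_comm] using this
  -- The Knill-Laflamme constant of the matrix unit at `(a', a)` is the entry `(a, a')` of the
  -- reduced state on `A`.
  choose G hG using fun a a' => hA (Matrix.single a' a 1)
  choose H hH using fun b b' => hB (Matrix.single b' b 1)
  have key := card_le_card_of_no_information ψ ?_ (Matrix.of G) (Matrix.of H) ?_ ?_
  · rwa [Fintype.card_fin, Fintype.card_fun, Fintype.card_fin, Fintype.card_coe] at key
  · intro hψ
    apply v.orthonormal.ne_zero ⟨0, h0⟩
    ext x
    obtain ⟨⟨a, b, c⟩, rfl⟩ := (splitWords q h).symm.surjective x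
    exact congrFun (congrFun (congrFun (congrFun hψ ⟨0, h0⟩) a) b) c
  · intro i i' a a'
    have := hG a a' (v i') (v i').2 (v i) (v i).2
    rw [hv, inner_splitWords h] at this
    simp only [localOp_splitWords_left, Matrix.single_apply] at this
    simp only [RCLike.star_def, Matrix.of_apply, ψ]
    simpa [ite_and, mul_comm (starRingEnd ℂ _)] using this
  · intro i i' b b'
    have := hH b b' (v i') (v i').2 (v i) (v i).2
    rw [hv, inner_splitWords h] at this
    simp only [localOp_splitWords_right, Matrix.single_apply] at this
    simp only [RCLike.star_def, Matrix.of_apply, ψ]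
    simpa [ite_and, mul_comm (starRingEnd ℂ _)] using this

end Singleton

/-! ### Enlarging an erasure along a recovery order. -/

section Erasure

variable {n q t : ℕ}

/-- Qudits of `M` that can be recovered one after the other, without the erasure `E`, may be erased
in addition to `E`. -/
theorem Correctable.union_of_order (hq : 2 ≤ q) {C : Submodule ℂ (QuditSpace n q)}
    {Γ : Fin t → Fin n → Finset (Fin n)} (hmem : ∀ l j, j ∈ Γ l j)
    (hR : ∀ (l : Fin t) (j : Fin n), ∃ R : LocalChannel q (Γ l j),
      ∀ ψ ∈ C, ‖ψ‖ = 1 → R.apply (traceOut j (pureState ψ)) = pureState ψ)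
    {M E J : Finset (Fin n)} (hE : Correctable C E) (hJM : J ⊆ M) (σ : Equiv.Perm (Fin n))
    (hσ : ∀ j ∈ J, ∃ l, Disjoint E (Γ l j) ∧ ∀ i ∈ Γ l j, i ∈ M → σ i ≤ σ j) :
    Correctable C (E ∪ J) := by
  -- The new qudit `a` precedes all of `J`, while the part of its recovery set in `M` ends at `a`;
  -- hence the recovery set misses `J`.
  induction J using Finset.induction_on_min_value (fun i => σ i) with
  | empty => simpa using hE
  | insert a J ha hmin ih =>
    have ih := ih ((Finset.subset_insert a J).trans hJM)
      fun j hj => hσ j (Finset.mem_insert_of_mem hj)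
    obtain ⟨l, hl, hlast⟩ := hσ a (Finset.mem_insert_self a J)
    obtain ⟨R, hR⟩ := hR l a
    rw [Finset.union_insert]
    refine ih.insert hq (hmem l a) (Finset.disjoint_union_left.mpr
      ⟨hl, Finset.disjoint_left.mpr fun i hi hi' => ha ?_⟩) R hR
    have h := le_antisymm (hmin i hi) (hlast i hi' (hJM (Finset.mem_insert_of_mem hi)))
    rwa [σ.injective h]

theorem exists_correctable (hq : 2 ≤ q) {C : Submodule ℂ (QuditSpace n q)} {r s d : ℕ} (hd : 1 ≤ d)
    (hC : HasDistance C d) (hL : IsExactQLRC C r t s) (M : Finset (Fin n)) (he : d - 1 ≤ M.card) :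
    ∃ A ⊆ M, Correctable C A ∧ A.card = d - 1 + calN₁ M.card (d - 1) r t s := by
  obtain ⟨Γ, hΓ, hR⟩ := hL
  obtain ⟨E, hEM, hEc, J, hJM, hJc, σ, hσ⟩ := hΓ.exists_erasure M (d - 1) he
  refine ⟨E ∪ J, Finset.union_subset hEM hJM, Correctable.union_of_order hq hΓ.mem hR
    (hC E (by omega)) hJM σ hσ, ?_⟩
  rw [Finset.card_union_of_disjoint, hEc, hJc]
  -- A recovery set of `j` contains `j` and avoids `E`, so `J` misses `E` and the sizes add up.
  refine Finset.disjoint_left.mpr fun j hj hj' => ?_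
  obtain ⟨l, hl, -⟩ := hσ j hj'
  exact Finset.disjoint_left.mp hl hj (hΓ.mem l j)

end Erasure

/-! ### The bound from two successive erasures. -/

theorem mainTheorem4 (n k d r t s q : ℕ) (hq : 2 ≤ q) (hk : 1 ≤ k) (hd : 1 ≤ d)
    (hr : 1 ≤ r) (ht : 1 ≤ t) (hs : 1 ≤ s)
    (C : Submodule ℂ (QuditSpace n q)) (hC : IsQuantumCode C k d) (hL : IsExactQLRC C r t s) :
    (k : ℤ) ≤ (n : ℤ) - 2 * ((d : ℤ) - 1) - (calN₁ (n : ℤ) (d - 1) r t s : ℤ) -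
      (calN₁ ((n : ℤ) - ((d : ℤ) - 1) - (calN₁ (n : ℤ) (d - 1) r t s : ℤ))
        (d - 1) r t s : ℤ) := by
  have hbound {A B : Finset (Fin n)} (h : Disjoint A B) (hA : Correctable C A)
      (hB : Correctable C B) : k ≤ (A ∪ B)ᶜ.card := by
    have := finrank_le_of_correctable C h hA hB
    rwa [hC.finrank_eq, Nat.pow_le_pow_iff_right hq] at this
  -- As `k ≥ 1`, fewer than `d` qudits cannot be the complement of a correctable set. This leaves
  -- room for `d - 1` erasures in `[n]` and again in `Aᶜ`.
  have hlarge {A B : Finset (Fin n)} (hA : Correctable C A) (hB : B.card < d) (h : Disjoint A B)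
      (hu : A ∪ B = Finset.univ) : False := by
    have := hbound h hA (hC.distance B hB)
    rw [hu] at this
    simp at this
    omega
  have hempty : Correctable C ∅ := hC.distance ∅ (by simp; omega)
  have hn : d - 1 ≤ (Finset.univ : Finset (Fin n)).card := by
    by_contra! h
    exact hlarge hempty (B := Finset.univ) (by omega) (by simp) (by simp)
  obtain ⟨A, -, hA, hAc⟩ := exists_correctable hq hd hC.distance hL Finset.univ hn
  have hm : d - 1 ≤ Aᶜ.card := by
    by_contra! h
    exact hlarge hA (B := Aᶜ) (by omega) disjoint_compl_right (by simp)
  obtain ⟨B, hBA, hB, hBc⟩ := exists_correctable hq hd hC.distance hL Aᶜ hm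
  have hAB : Disjoint A B := disjoint_compl_right.mono_right hBA
  have hk := hbound hAB hA hB
  have h1 := Finset.card_compl_add_card A
  have h2 := Finset.card_compl_add_card (A ∪ B)
  rw [Finset.card_union_of_disjoint hAB] at h2
  rw [Finset.card_univ, Fintype.card_fin] at hAc
  rw [Fintype.card_fin] at h1 h2
  have hmA : ((Aᶜ.card : ℕ) : ℤ) = (n : ℤ) - ((d : ℤ) - 1) - (calN₁ (n : ℤ) (d - 1) r t s : ℤ) := by
    omega
  rw [hmA] at hBc
  omega
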